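/- Let $n\ge 0$, $p>1$, let $A_0,\dots,A_n$ be real symmetric $p\times p$ matrices, $c\in\mathbb R^n$, $\mathcal A(x)=A_0+\sum_{j=1}^n x_jA_j$, and consider the linear copositive problem $\min c^\top x$ s.t. $\mathcal A(x)\in\mathcal{COP}^p$, where $\mathcal{COP}^p$ is the cone of symmetric $D$ with $t^\top Dt\ge 0$ for all $t\in\mathbb R^p_+$, considered in the space of symmetric matrices. Let $X$ be its feasible set and assume $X\neq\emptyset$. Put $P=\{1,\dots,p\}$, $T=\{t\in\mathbb R^p_+:\sum_k t_k=1\}$, $T_{im}=\{t\in T: t^\top\mathcal A(x)t=0\ \forall x\in X\}$ (the normalized immobile indices), $P_+(t)=\{k:t_k>0\}$. For a finite nonempty $V\subset T$ let $\sigma(V)=\min\{v_k: v\in V,\ k\in P_+(v)\}$ and $\Omega(V)=\{t\in T:\min_{\tau\in\operatorname{conv}V}\sum_k|t_k-\tau_k|\ge\sigma(V)\}$; put $\Omega(\emptyset)=T$. The algorithm REG-LCoP maintains a finite index set $I_m$ (with $I_0=\emptyset$), points $\tau(i)\in T$ and sets $L_m(i)\subset P$ for $i\in I_m$; write $W_m=\{\tau(i):i\in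 I_m\}$. At iteration $m\ge 0$ consider the semi-infinite problem $(SIP_m)$ of minimizing $\mu$ over $(x,\mu)\in\mathbb R^{n+1}$ subject to $$e_k^\top\mathcal A(x)\tau(i)=0\ (k\in L_m(i)),\quad e_k^\top\mathcal A(x)\tau(i)\ge 0\ (k\in P\setminus L_m(i)),\quad i\in I_m;\qquad t^\top\mathcal A(x)t+\mu\ge 0\ \ \forall t\in\Omega(W_m).$$ If $(SIP_m)$ has a feasible point $(\bar x,\bar\mu)$ with $\bar\mu<0$, the algorithm stops with $m_*:=m$ and returns the current data and such an $\bar x$. Otherwise: * if $m=0$, it chooses a finite set $I_1$ with $|I_1|\le n+1$, points $\tau(i)\in T$ and numbers $\gamma(i)>0$, $i\in I_1$, with $\sum_{i\in I_1}\gamma(i)=1$ and $\sum_{i\in I_1}\gamma(i)\tau(i)^\top A_j\tau(i)=0$ for $j=0,\dots,n$, and sets $L_1(i)=P_+(\tau(i))$; * if $m\ge1$, it chooses a finite set $\Delta I_m$ disjoint from $I_m$ with $1\le|\Delta I_m|\le n+1$, points $\tau(i)\in\Omega(W_m)$ and numbers $\gamma(i)>0$ for $i\in\Delta I_m$, and vectors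 $\lambda(i)\in\mathbb R^p$ for $i\in I_m$ with $\lambda_k(i)\ge0$ for $k\notin L_m(i)$, such that $$\sum_{i\in\Delta I_m}\gamma(i)\tau(i)^\top A_j\tau(i)+2\sum_{i\in I_m}\lambda(i)^\top A_j\tau(i)=0,\quad j=0,\dots,n,$$ and $P_+(\tau(j))\not\subset P_+(\tau(i))$ for all $i\in\Delta I_m$, $j\in I_m$; it sets $I_{m+1}=I_m\cup\Delta I_m$, $L_{m+1}(i)=L_m(i)\cup\{k\notin L_m(i):\lambda_k(i)>0\}$ for $i\in I_m$, and $L_{m+1}(i)=P_+(\tau(i))$ for $i\in\Delta I_m$. (The rules use the problem data and the current working data only; $T_{im}$ is not needed.) Then: 1. The algorithm is well defined: whenever a run reaches an iteration $m$ at which the stopping test fails, data as required in that iteration exist. 2. There is no infinite run: whatever choices are made, the algorithm stops after a finite number $m_*$ of iterations; in particular a run that stops exists. 3. For every run that stops, at iteration $m_*$, and every feasible $(\bar x,\bar\mu)$ of $(SIP_{m_*})$ with $\bar\mu<0$: * if $m_*=0$, the Slater condition holds at $\bar x$: $\mathcal A(\bar x)\in\operatorname{int}\mathcal{COP}^p$;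 if $m_*>0$, then $I_{m_*}\ne\emptyset$; * for all $i\in I_{m_*}$: $\tau(i)\in T_{im}$, $P_+(\tau(i))\subset L_{m_*}(i)$, and $e_k^\top\mathcal A(x)\tau(i)=0$ for all $k\in L_{m_*}(i)$, $x\in X$; * $\Omega(W_{m_*})$ is compact, $\bar x\in X$, and $t^\top\mathcal A(\bar x)t>0$ for all $t\in\Omega(W_{m_*})$; * the set of $x\in\mathbb R^n$ with $e_k^\top\mathcal A(x)\tau(i)=0$ for $k\in L_{m_*}(i)$, $e_k^\top\mathcal A(x)\tau(i)\ge0$ for $k\in P\setminus L_{m_*}(i)$ ($i\in I_{m_*}$), and $t^\top\mathcal A(x)t\ge0$ for all $t\in\Omega(W_{m_*})$, equals $X$; hence minimizing $c^\top x$ over this set has the same optimal solutions as the original problem. -/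

import Mathlib

open scoped Matrix

noncomputable section

namespace LinCop

/-- The space `S(p)` of real symmetric `p × p` matrices, a subspace of all `p × p` matrices. -/
def SymMat (p : ℕ) : Submodule ℝ (Matrix (Fin p) (Fin p) ℝ) where
  carrier := {D | D.IsSymm}
  add_mem' := fun ha hb => Matrix.IsSymm.add ha hb
  zero_mem' := Matrix.isSymm_zero
  smul_mem' := fun k _ ha => Matrix.IsSymm.smul ha k

/-- The quadratic form `tᵀ D t`. -/
def quad {p : ℕ} (D : SymMat p) (t : Fin p → ℝ) : ℝ :=
  t ⬝ᵥ ((D : Matrix (Fin p) (Fin p) ℝ) *ᵥ t)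

/-- The entry `e_kᵀ D t`. -/
def row {p : ℕ} (D : SymMat p) (k : Fin p) (t : Fin p → ℝ) : ℝ :=
  ((D : Matrix (Fin p) (Fin p) ℝ) *ᵥ t) k

/-- The cone of copositive matrices, as a subset of the space of symmetric matrices. -/
def COP (p : ℕ) : Set (SymMat p) :=
  {D | ∀ t : Fin p → ℝ, (∀ k, 0 ≤ t k) → 0 ≤ quad D t}

/-- The simplex `T = {t ≥ 0 : eᵀ t = 1}`. -/
def T (p : ℕ) : Set (Fin p → ℝ) := stdSimplex ℝ (Fin p)

/-- The support `P₊(t) = {k : t_k > 0}`. -/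
def posPart {p : ℕ} (t : Fin p → ℝ) : Finset (Fin p) := {k | 0 < t k}

/-- The `ℓ¹` distance from the point `l` to the set `B`. -/
def rho {p : ℕ} (l : Fin p → ℝ) (B : Set (Fin p → ℝ)) : ℝ :=
  sInf ((fun τ => ∑ k, |l k - τ k|) '' B)

/-- `σ(V)`: the least positive coordinate of the points of `V` (a minimum when `V` is a finite
nonempty subset of the simplex). -/
def sigma {p : ℕ} (V : Set (Fin p → ℝ)) : ℝ :=
  sInf {r | ∃ v ∈ V, ∃ k ∈ posPart v, r = v k}

/-- `Ω(V) = {t ∈ T : ρ(t, conv V) ≥ σ(V)}` for nonempty `V`; for `V = ∅` no condition besides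
`t ∈ T` is imposed. -/
def Omega {p : ℕ} (V : Set (Fin p → ℝ)) : Set (Fin p → ℝ) :=
  {t | t ∈ T p ∧ (V.Nonempty → sigma V ≤ rho t (convexHull ℝ V))}

/-- Data of the linear copositive problem
`min cᵀx` subject to `A₀ + ∑ xⱼ Aⱼ` copositive, with symmetric `A₀, …, Aₙ`. -/
structure Problem (n p : ℕ) where
  A : Fin (n + 1) → SymMat p
  c : Fin n → ℝ

/-- The working data of the algorithm: a finite index set `I` and, for `i ∈ I`, a point `τ i` and
a set `L i` of coordinates. The values of `τ` and `L` outside `I` are irrelevant. -/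
structure State (p : ℕ) where
  I : Finset ℕ
  τ : ℕ → Fin p → ℝ
  L : ℕ → Finset (Fin p)

/-- `W = {τ(i) : i ∈ I}`. -/
def State.W {p : ℕ} (s : State p) : Set (Fin p → ℝ) := s.τ '' (s.I : Set ℕ)

namespace Problem

variable {n p : ℕ}

/-- The constraint function `𝒜(x) = A₀ + ∑ xⱼ Aⱼ`. -/
def mat (P : Problem n p) (x : Fin n → ℝ) : SymMat p :=
  P.A 0 + ∑ j : Fin n, x j • P.A j.succ

/-- The feasible set of the copositive problem. -/
def X (P : Problem n p) : Set (Fin n → ℝ) := {x | P.mat x ∈ COP p}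

/-- The set of normalized immobile indices. -/
def Tim (P : Problem n p) : Set (Fin p → ℝ) :=
  {t | t ∈ T p ∧ ∀ x ∈ P.X, quad (P.mat x) t = 0}

/-- `x` minimizes the objective `cᵀx` over the set `S`. -/
def IsOptimalOver (P : Problem n p) (S : Set (Fin n → ℝ)) (x : Fin n → ℝ) : Prop :=
  x ∈ S ∧ ∀ y ∈ S, P.c ⬝ᵥ x ≤ P.c ⬝ᵥ y

/-- The finitely many linear constraints attached to the working data:
`e_kᵀ 𝒜(x) τ(i) = 0` for `k ∈ L(i)` and `e_kᵀ 𝒜(x) τ(i) ≥ 0` for `k ∉ L(i)`. -/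
def LinearConstraints (P : Problem n p) (s : State p) (x : Fin n → ℝ) : Prop :=
  ∀ i ∈ s.I, (∀ k ∈ s.L i, row (P.mat x) k (s.τ i) = 0) ∧
    ∀ k, k ∉ s.L i → 0 ≤ row (P.mat x) k (s.τ i)

/-- Feasibility of `(x, μ)` in the auxiliary semi-infinite problem `min μ`.  When `I = ∅` this is
the problem of iteration `0`, with the single constraint `tᵀ𝒜(x)t + μ ≥ 0` on the whole simplex. -/
def SIPFeasible (P : Problem n p) (s : State p) (x : Fin n → ℝ) (μ : ℝ) : Prop :=
  P.LinearConstraints s x ∧ ∀ t ∈ Omega s.W, 0 ≤ quad (P.mat x) t + μ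

/-- The stopping test. -/
def Stops (P : Problem n p) (s : State p) : Prop :=
  ∃ x μ, P.SIPFeasible s x μ ∧ μ < 0

/-- The feasible set of the regularized semi-infinite problem. -/
def regFeasible (P : Problem n p) (s : State p) : Set (Fin n → ℝ) :=
  {x | P.LinearConstraints s x ∧ ∀ t ∈ Omega s.W, 0 ≤ quad (P.mat x) t}

/-- The data `s'` can be produced at iteration `0` (when the stopping test fails). -/
def FirstStep (P : Problem n p) (s' : State p) : Prop :=
  ∃ γ : ℕ → ℝ,
    s'.I.card ≤ n + 1 ∧
    (∀ i ∈ s'.I, s'.τ i ∈ T p ∧ 0 < γ i ∧ s'.L i = posPart (s'.τ i)) ∧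
    (∀ j : Fin (n + 1), ∑ i ∈ s'.I, γ i * quad (P.A j) (s'.τ i) = 0) ∧
    ∑ i ∈ s'.I, γ i = 1

/-- The data `s'` can be produced from `s` at an iteration `m ≥ 1` (when the stopping test fails).
`Δ` is the set of new indices, `γ` and `lam` are the multipliers. -/
def NextStep (P : Problem n p) (s s' : State p) : Prop :=
  ∃ (Δ : Finset ℕ) (γ : ℕ → ℝ) (lam : ℕ → Fin p → ℝ),
    Disjoint Δ s.I ∧ 1 ≤ Δ.card ∧ Δ.card ≤ n + 1 ∧
    (∀ i ∈ Δ, s'.τ i ∈ Omega s.W ∧ 0 < γ i) ∧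
    (∀ i ∈ s.I, ∀ k, k ∉ s.L i → 0 ≤ lam i k) ∧
    (∀ j : Fin (n + 1), ∑ i ∈ Δ, γ i * quad (P.A j) (s'.τ i) +
      2 * ∑ i ∈ s.I, ∑ k, lam i k * row (P.A j) k (s.τ i) = 0) ∧
    (∀ i ∈ Δ, ∀ j ∈ s.I, ∃ k, k ∉ posPart (s'.τ i) ∧ k ∈ posPart (s.τ j)) ∧
    s'.I = s.I ∪ Δ ∧
    (∀ i ∈ s.I, s'.τ i = s.τ i) ∧
    (∀ i ∈ s.I, s'.L i = s.L i ∪ Finset.univ.filter (fun k => k ∉ s.L i ∧ 0 < lam i k)) ∧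
    (∀ i ∈ Δ, s'.L i = posPart (s'.τ i))

/-- The data-updating part of iteration number `m`. -/
def Step (P : Problem n p) : ℕ → State p → State p → Prop
  | 0, _, s' => P.FirstStep s'
  | _ + 1, s, s' => P.NextStep s s'

/-- `s 0, …, s m` are the working data at the beginning of iterations `0, …, m` in some run of the
algorithm which has not stopped before iteration `m`. -/
def IsRun (P : Problem n p) (m : ℕ) (s : ℕ → State p) : Prop :=
  (s 0).I = ∅ ∧ ∀ k < m, ¬ P.Stops (s k) ∧ P.Step k (s k) (s (k + 1))

end Problem

end LinCop

end

/-! The run preserves the invariant `Immobile`, and the geometry rests on `reducedSet W`, the points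
of the simplex whose support contains no support of a point of `W`. This set is compact and lies in
`Omega W`. Every `t` in the simplex is `u + r • w` with `u` a nonnegative multiple of a point of
`reducedSet W`, `r ≥ 0` and `w ∈ conv W`. If the linear constraints hold, all rows are nonnegative
at `w`, so the form at `t` is at least the form at `u` (`exists_quad_le`). Hence nonnegativity on
`reducedSet W` already gives copositivity, so the regularized feasible set is `X`
(`regFeasible_eq`). Positivity on `reducedSet W` gives positivity on `Omega W`, which misses `conv
W`, so the test succeeds (`stops_of_pos`).

If the test fails, no `x` satisfies the linear constraints with a form positive on `reducedSet W`. A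
theorem of the alternative then supplies multipliers and points of `reducedSet W`, which meet the
support rule automatically (`exists_certificate`). Evaluated at a feasible `x`, the multiplier
identity is a vanishing sum of nonnegative terms. So every term is zero, which propagates the
invariant and also saves one point in Carathéodory's bound.

A newly chosen support never contains an older one, so from iteration 1 on each iteration
contributes a new subset of a finite set, and the run is finite. -/

namespace LinCop

/-! ### Finitely generated cones, separation and Carathéodory bounds. -/

section Cone

variable {ι E : Type*}

/-- The nonnegative combinations of the vectors `v i`, `i ∈ s`. -/
def finsetCone [AddCommGroup E] [Module ℝ E] (v : ι → E) (s : Finset ι) : Set E :=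
  {x | ∃ c : ι → ℝ, (∀ i, 0 ≤ c i) ∧ ∑ i ∈ s, c i • v i = x}

theorem finsetCone_mono [AddCommGroup E] [Module ℝ E] (v : ι → E) {s t : Finset ι} (h : s ⊆ t) :
    finsetCone v s ⊆ finsetCone v t := by
  classical
  rintro x ⟨c, hc, rfl⟩
  refine ⟨fun i => if i ∈ s then c i else 0, fun i => by dsimp only; split_ifs <;> simp [hc], ?_⟩
  rw [← Finset.sum_subset h]
  · exact Finset.sum_congr rfl fun i hi => by simp [hi]
  · intro i _ hi
    simp [hi]

/-- The reduction step of Carathéodory's theorem for cones. -/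
theorem exists_mem_finsetCone_erase [DecidableEq ι] [AddCommGroup E] [Module ℝ E] {v : ι → E}
    {s : Finset ι} (hs : ¬ LinearIndepOn ℝ v (s : Set ι)) {x : E} (hx : x ∈ finsetCone v s) :
    ∃ i ∈ s, x ∈ finsetCone v (s.erase i) := by
  obtain ⟨c, hc, rfl⟩ := hx
  obtain ⟨g, hg, i₀, hi₀, hpos⟩ : ∃ g : ι → ℝ, ∑ i ∈ s, g i • v i = 0 ∧ ∃ i ∈ s, 0 < g i := by
    rw [linearIndepOn_finset_iff] at hs
    push Not at hs
    obtain ⟨g, hg, i, hi, hne⟩ := hs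
    rcases hne.lt_or_gt with h | h
    · exact ⟨-g, by simp [hg], i, hi, by simpa using h⟩
    · exact ⟨g, hg, i, hi, h⟩
  -- The minimal ratio is the largest multiple of the relation `g` that can be subtracted from `c`
  -- without leaving the orthant; it makes coefficient `i` vanish.
  obtain ⟨i, hi, hmin⟩ := (s.filter fun i => 0 < g i).exists_min_image (fun i => c i / g i)
    ⟨i₀, by simp [hi₀, hpos]⟩
  rw [Finset.mem_filter] at hi
  refine ⟨i, hi.1, fun j => if j ∈ s then c j - c i / g i * g j else 0, fun j => ?_, ?_⟩
  · dsimp only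
    split_ifs with hj
    · rcases le_or_gt (g j) 0 with h | h
      · have := div_nonneg (hc i) hi.2.le
        nlinarith [hc j]
      · have := hmin j (by simp [hj, h])
        rw [le_div_iff₀ h] at this
        linarith
    · exact le_rfl
  · rw [Finset.sum_erase]
    · calc _ = ∑ j ∈ s, (c j • v j - (c i / g i) • g j • v j) :=
            Finset.sum_congr rfl fun j hj => by simp [hj, sub_smul, mul_smul]
        _ = _ := by rw [Finset.sum_sub_distrib, ← Finset.smul_sum, hg, smul_zero, sub_zero]
    · simp [hi.1, div_mul_cancel₀ _ hi.2.ne']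

/-- Finitely generated cones are closed. -/
theorem isClosed_finsetCone [NormedAddCommGroup E] [NormedSpace ℝ E] [FiniteDimensional ℝ E]
    (v : ι → E) (s : Finset ι) : IsClosed (finsetCone v s) := by
  classical
  induction s using Finset.strongInduction with
  | H s ih =>
    by_cases hs : LinearIndepOn ℝ v (s : Set ι)
    · let f : (s → ℝ) →ₗ[ℝ] E := Fintype.linearCombination ℝ fun i : s => v i
      have hf : Topology.IsClosedEmbedding f := by
        refine LinearMap.isClosedEmbedding_of_injective ?_
        exact LinearMap.ker_eq_bot'.2 fun c hc =>
          funext ((Fintype.linearIndependent_iff (v := fun i : s => v i)).1 hs c hc)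
      have : finsetCone v s = f '' {c | ∀ i, 0 ≤ c i} := by
        ext x
        constructor
        · rintro ⟨c, hc, rfl⟩
          exact ⟨fun i => c i, fun i => hc i, by
            simp only [f, Fintype.linearCombination_apply]
            exact Finset.sum_coe_sort s fun i => c i • v i⟩
        · rintro ⟨c, hc, rfl⟩
          refine ⟨fun i => if h : i ∈ s then c ⟨i, h⟩ else 0,
            fun i => by dsimp only; split_ifs <;> simp [hc _], ?_⟩
          simp only [f, Fintype.linearCombination_apply]
          rw [← Finset.sum_coe_sort s]
          exact Finset.sum_congr rfl fun i _ => by simp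
      rw [this]
      refine hf.isClosedMap _ ?_
      simp only [Set.ofPred_forall]
      exact isClosed_iInter fun i => isClosed_le continuous_const (continuous_apply i)
    -- Dependent generators: the cone is a finite union of smaller cones, closed by induction. In
    -- the independent case it was a closed embedding of an orthant.
    · have : finsetCone v s = ⋃ i ∈ s, finsetCone v (s.erase i) := by
        ext x
        simp only [Set.mem_iUnion, exists_prop]
        exact ⟨exists_mem_finsetCone_erase hs,
          fun ⟨i, _, h⟩ => finsetCone_mono v (s.erase_subset i) h⟩
      rw [this]
      exact s.finite_toSet.isClosed_biUnion fun i hi => ih _ (Finset.erase_ssubset hi)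

theorem convex_finsetCone [AddCommGroup E] [Module ℝ E] (v : ι → E) (s : Finset ι) :
    Convex ℝ (finsetCone v s) := by
  rintro _ ⟨c, hc, rfl⟩ _ ⟨d, hd, rfl⟩ a b ha hb _
  refine ⟨fun i => a * c i + b * d i,
    fun i => add_nonneg (mul_nonneg ha (hc i)) (mul_nonneg hb (hd i)), ?_⟩
  simp only [add_smul, mul_smul, Finset.sum_add_distrib, Finset.smul_sum]

/-- A theorem of the alternative for a compact convex set and a finite system of linear
inequalities, those with index in `F` being equations. -/
theorem exists_mem_add_sum_eq_zero_or_exists_pos [Fintype ι] [NormedAddCommGroup E]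
    [NormedSpace ℝ E] [FiniteDimensional ℝ E] {K : Set E} (hK : IsCompact K) (hKc : Convex ℝ K)
    (b : ι → E) (F : Set ι) :
    (∃ z ∈ K, ∃ c : ι → ℝ, (∀ i, i ∉ F → 0 ≤ c i) ∧ z + ∑ i, c i • b i = 0) ∨
    ∃ f : E →ₗ[ℝ] ℝ, (∀ z ∈ K, 0 < f z) ∧ (∀ i, 0 ≤ f (b i)) ∧ ∀ i ∈ F, f (b i) = 0 := by
  classical
  -- Both signs of `b i` occur for `i ∈ F`, which frees the sign of its multiplier and forces the
  -- functional to vanish there.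
  let v : ι ⊕ ι → E := Sum.elim (fun i => -b i) fun i => if i ∈ F then b i else 0
  let C := finsetCone v Finset.univ
  have hC0 : (0 : E) ∈ C := ⟨0, by simp, by simp⟩
  have hCs : ∀ k, ∀ r : ℝ, 0 ≤ r → r • v k ∈ C := fun k r hr =>
    ⟨Pi.single k r, fun i => by by_cases h : i = k <;> simp [h, hr],
      by simp [Pi.single_apply, ite_smul]⟩
  by_cases hd : Disjoint K C
  · right
    obtain ⟨f, u, w, hu, huw, hw⟩ := geometric_hahn_banach_compact_closed hKc hK
      (convex_finsetCone v Finset.univ) (isClosed_finsetCone v Finset.univ) hd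
    have hw0 : w < 0 := by simpa using hw 0 hC0
    have hfv : ∀ k, 0 ≤ f (v k) := by
      intro k
      by_contra! h
      -- This multiple of `v k` would have value exactly `w`, yet `f > w` on the cone.
      have := hw _ (hCs k (w / f (v k)) (div_nonneg_of_nonpos hw0.le h.le))
      simp [div_mul_cancel₀ _ h.ne] at this
    have h1 : ∀ i, f (b i) ≤ 0 := fun i => by simpa [v] using hfv (Sum.inl i)
    refine ⟨-f.toLinearMap, fun z hz => ?_, fun i => by simpa using h1 i, fun i hi => ?_⟩
    · have := hu z hz
      simp only [LinearMap.neg_apply, ContinuousLinearMap.coe_coe]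
      linarith
    · have := hfv (Sum.inr i)
      simp only [v, Sum.elim_inr, if_pos hi] at this
      simp [le_antisymm (h1 i) this]
  · left
    obtain ⟨z, hz, c, hc, rfl⟩ := Set.not_disjoint_iff.1 hd
    refine ⟨_, hz, fun i => c (.inl i) - if i ∈ F then c (.inr i) else 0, fun i hi => ?_, ?_⟩
    · simp [hi, hc]
    · rw [Fintype.sum_sum_type, ← Finset.sum_add_distrib, ← Finset.sum_add_distrib]
      refine Finset.sum_eq_zero fun i _ => ?_
      by_cases hi : i ∈ F
      · simp only [v, Sum.elim_inl, Sum.elim_inr, if_pos hi]; module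
      · simp only [v, Sum.elim_inl, Sum.elim_inr, if_neg hi]; module

/-- An affinely independent family in the kernel of a nonzero functional has at most as many
members as the dimension of the space. -/
theorem card_le_finrank_of_affineIndependent_of_ker [Fintype ι] [AddCommGroup E] [Module ℝ E]
    [FiniteDimensional ℝ E] {z : ι → E} (hz : AffineIndependent ℝ z) {f : E →ₗ[ℝ] ℝ}
    (hf : f ≠ 0) (h : ∀ i, f (z i) = 0) : Fintype.card ι ≤ Module.finrank ℝ E := by
  have h1 : vectorSpan ℝ (Set.range z) ≤ LinearMap.ker f := by
    refine Submodule.span_le.2 ?_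
    rintro _ ⟨_, ⟨i, rfl⟩, _, ⟨j, rfl⟩, rfl⟩
    simp [h]
  have h2 : LinearMap.ker f < ⊤ := lt_top_iff_ne_top.2 fun h => hf (LinearMap.ker_eq_top.1 h)
  have := hz.card_le_finrank_succ
  have := Submodule.finrank_mono h1
  have := Submodule.finrank_lt h2.ne
  lia

/-- In finite dimension the convex hull of a compact set is compact. -/
theorem isCompact_convexHull_of_isCompact [NormedAddCommGroup E] [NormedSpace ℝ E]
    [FiniteDimensional ℝ E] {K : Set E} (hK : IsCompact K) : IsCompact (convexHull ℝ K) := by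
  rcases K.eq_empty_or_nonempty with rfl | ⟨x₀, hx₀⟩
  · simp
  -- By Carathéodory, `N` points suffice; shorter combinations are padded with `x₀` at weight zero.
  let N := Module.finrank ℝ E + 1
  have hc : IsCompact ((fun q : (Fin N → ℝ) × (Fin N → E) => ∑ i, q.1 i • q.2 i) ''
      (stdSimplex ℝ (Fin N) ×ˢ Set.univ.pi fun _ => K)) :=
    ((isCompact_stdSimplex ℝ (Fin N)).prod (isCompact_univ_pi fun _ => hK)).image (by fun_prop)
  convert hc using 1
  refine subset_antisymm (fun x hx => ?_) ?_
  · obtain ⟨κ, _, z, w, hz, hind, hw, hw1, rfl⟩ := eq_pos_convex_span_of_mem_convexHull hx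
    have hcard : Fintype.card κ ≤ N :=
      hind.card_le_finrank_succ.trans (Nat.succ_le_succ (Submodule.finrank_le _))
    obtain ⟨φ⟩ : Nonempty (κ ↪ Fin N) :=
      Function.Embedding.nonempty_of_card_le (by simpa using hcard)
    have hw0 : ∀ j, j ∉ Set.range φ → Function.extend φ w 0 j = 0 := fun j hj =>
      Function.extend_apply' _ _ _ hj
    refine ⟨(Function.extend φ w 0, Function.extend φ z fun _ => x₀), ⟨⟨fun j => ?_, ?_⟩,
      fun j _ => ?_⟩, ?_⟩
    · by_cases hj : j ∈ Set.range φ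
      · obtain ⟨i, rfl⟩ := hj
        dsimp only
        rw [φ.injective.extend_apply]
        exact (hw i).le
      · exact (hw0 j hj).ge
    · rw [Fintype.sum_of_injective φ φ.injective w _ hw0
        fun i => (φ.injective.extend_apply _ _ _).symm] at hw1
      exact hw1
    · by_cases hj : j ∈ Set.range φ
      · obtain ⟨i, rfl⟩ := hj
        dsimp only
        rw [φ.injective.extend_apply]
        exact hz ⟨i, rfl⟩
      · dsimp only
        rw [Function.extend_apply' _ _ _ hj]
        exact hx₀
    · refine (Fintype.sum_of_injective φ φ.injective _ _ (fun j hj => ?_) fun i => ?_).symm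
      · dsimp only
        rw [hw0 j hj, zero_smul]
      · dsimp only
        rw [φ.injective.extend_apply, φ.injective.extend_apply]
  · rintro _ ⟨⟨w, z⟩, ⟨hw, hz⟩, rfl⟩
    exact (convex_convexHull ℝ K).sum_mem (fun i _ => hw.1 i) hw.2
      fun i hi => subset_convexHull ℝ K (hz i (Set.mem_univ i))

end Cone

/-! ### Quadratic forms on the simplex and copositivity. -/

section Forms

variable {p : ℕ}

theorem quad_eq_sum (D : SymMat p) (t : Fin p → ℝ) : quad D t = ∑ k, t k * row D k t := rfl

theorem row_add_right (D : SymMat p) (k : Fin p) (t u : Fin p → ℝ) :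
    row D k (t + u) = row D k t + row D k u := by
  simp [row, Matrix.mulVec_add]

theorem row_smul_right (D : SymMat p) (k : Fin p) (r : ℝ) (t : Fin p → ℝ) :
    row D k (r • t) = r * row D k t := by
  simp [row, Matrix.mulVec_smul]

theorem sum_mul_row_comm (D : SymMat p) (t u : Fin p → ℝ) :
    ∑ k, t k * row D k u = ∑ k, u k * row D k t := by
  have h : (D : Matrix (Fin p) (Fin p) ℝ)ᵀ = D := D.2
  change t ⬝ᵥ ((D : Matrix (Fin p) (Fin p) ℝ) *ᵥ u) = u ⬝ᵥ ((D : Matrix (Fin p) (Fin p) ℝ) *ᵥ t)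
  rw [Matrix.dotProduct_mulVec, ← Matrix.mulVec_transpose, h, dotProduct_comm]

theorem quad_add_right (D : SymMat p) (t u : Fin p → ℝ) :
    quad D (t + u) = quad D t + 2 * ∑ k, t k * row D k u + quad D u := by
  have := sum_mul_row_comm D t u
  simp only [quad_eq_sum, row_add_right, Pi.add_apply, add_mul, mul_add, Finset.sum_add_distrib]
  linarith

theorem quad_smul_right (D : SymMat p) (r : ℝ) (t : Fin p → ℝ) :
    quad D (r • t) = r ^ 2 * quad D t := by
  simp only [quad_eq_sum, row_smul_right, Finset.mul_sum, Pi.smul_apply, smul_eq_mul]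
  exact Finset.sum_congr rfl fun k _ => by ring

theorem quad_zero_right (D : SymMat p) : quad D 0 = 0 := by simp [quad]

theorem continuous_quad : Continuous fun x : SymMat p × (Fin p → ℝ) => quad x.1 x.2 := by
  unfold quad
  fun_prop

theorem continuous_quad_right (D : SymMat p) : Continuous (quad D) :=
  continuous_quad.comp (by fun_prop : Continuous fun t : Fin p → ℝ => (D, t))

theorem quad_sum_smul {ι : Type*} (s : Finset ι) (y : ι → ℝ) (D : ι → SymMat p)
    (t : Fin p → ℝ) : quad (∑ j ∈ s, y j • D j) t = ∑ j ∈ s, y j * quad (D j) t := by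
  simp [quad, Matrix.sum_mulVec, Matrix.smul_mulVec, dotProduct_sum]

theorem row_sum_smul {ι : Type*} (s : Finset ι) (y : ι → ℝ) (D : ι → SymMat p)
    (k : Fin p) (t : Fin p → ℝ) : row (∑ j ∈ s, y j • D j) k t = ∑ j ∈ s, y j * row (D j) k t := by
  simp [row, Matrix.sum_mulVec, Matrix.smul_mulVec]

theorem mem_posPart {t : Fin p → ℝ} {k : Fin p} : k ∈ posPart t ↔ 0 < t k := by simp [posPart]

theorem T_nonneg {t : Fin p → ℝ} (ht : t ∈ T p) (k : Fin p) : 0 ≤ t k := ht.1 k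

theorem T_sum {t : Fin p → ℝ} (ht : t ∈ T p) : ∑ k, t k = 1 := ht.2

theorem isCompact_T (p : ℕ) : IsCompact (T p) := isCompact_stdSimplex ℝ (Fin p)

theorem inv_sum_smul_mem_T {t : Fin p → ℝ} (ht : ∀ k, 0 ≤ t k) (h : 0 < ∑ k, t k) :
    (∑ k, t k)⁻¹ • t ∈ T p :=
  ⟨fun k => mul_nonneg (inv_nonneg.2 h.le) (ht k), by
    simp [← Finset.mul_sum, inv_mul_cancel₀ h.ne']⟩

theorem sum_pos_of_ne_zero {t : Fin p → ℝ} (ht : ∀ k, 0 ≤ t k) (h : t ≠ 0) : 0 < ∑ k, t k := by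
  refine (Finset.sum_nonneg fun k _ => ht k).lt_of_ne' fun h0 => h ?_
  ext k
  exact (Finset.sum_eq_zero_iff_of_nonneg fun k _ => ht k).1 h0 k (Finset.mem_univ k)

theorem mem_COP_of_T {D : SymMat p} (h : ∀ t ∈ T p, 0 ≤ quad D t) : D ∈ COP p := by
  intro t ht
  by_cases h0 : t = 0
  · rw [h0, quad_zero_right]
  · have hs := sum_pos_of_ne_zero ht h0
    have := h _ (inv_sum_smul_mem_T ht hs)
    rw [quad_smul_right] at this
    exact nonneg_of_mul_nonneg_right this (by positivity)

/-- A matrix with a positive form on the simplex is an interior point of the copositive cone. -/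
theorem mem_interior_COP {D : SymMat p} (h : ∀ t ∈ T p, 0 < quad D t) : D ∈ interior (COP p) := by
  have ho : IsOpen {D : SymMat p | ∀ t ∈ T p, 0 < quad D t} := by
    rw [isOpen_iff_mem_nhds]
    intro D hD
    refine (isCompact_T p).eventually_forall_of_forall_eventually fun t ht => ?_
    exact continuous_quad.continuousAt.eventually_const_lt (hD t ht)
  exact mem_interior.2 ⟨_, fun D hD => mem_COP_of_T fun t ht => (hD t ht).le, ho, h⟩

/-- At a zero of a copositive form on the orthant the gradient is nonnegative. -/
theorem row_nonneg_of_mem_COP {D : SymMat p} (hD : D ∈ COP p) {t : Fin p → ℝ}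
    (ht : ∀ k, 0 ≤ t k) (h : quad D t = 0) (k : Fin p) : 0 ≤ row D k t := by
  by_contra! hr
  set d := quad D (Pi.single k 1)
  set r := row D k t
  have key : ∀ s : ℝ, 0 ≤ s → 0 ≤ 2 * (s * r) + s ^ 2 * d := by
    intro s hs
    have := hD (s • Pi.single k 1 + t) fun l => by
      have : (0 : ℝ) ≤ (Pi.single k 1 : Fin p → ℝ) l := by
        by_cases hl : l = k <;> simp [hl]
      exact add_nonneg (mul_nonneg hs this) (ht l)
    rw [quad_add_right, h, quad_smul_right] at this
    simp [Pi.single_apply] at this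
    linarith
  have h1 : 0 < |d| + 1 := by positivity
  -- The step is so short that `s * |d| < -r`; then the first-order term `2 * s * r` dominates and
  -- the form becomes negative.
  have h2 := key (-r / (|d| + 1)) (div_nonneg (by linarith) h1.le)
  set s := -r / (|d| + 1) with hs
  have h3 : s * (|d| + 1) = -r := div_mul_cancel₀ _ h1.ne'
  have h4 : 0 < s := div_pos (by linarith) h1
  have h5 : s * d ≤ s * |d| := mul_le_mul_of_nonneg_left (le_abs_self d) h4.le
  nlinarith

/-- Complementary slackness: `∑ k, t k * row D k t` vanishes and all its terms are nonnegative. -/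
theorem row_eq_zero_of_mem_COP {D : SymMat p} (hD : D ∈ COP p) {t : Fin p → ℝ}
    (ht : ∀ k, 0 ≤ t k) (h : quad D t = 0) {k : Fin p} (hk : k ∈ posPart t) : row D k t = 0 := by
  rw [quad_eq_sum, Finset.sum_eq_zero_iff_of_nonneg fun k _ =>
    mul_nonneg (ht k) (row_nonneg_of_mem_COP hD ht h k)] at h
  exact (mul_eq_zero.1 (h k (Finset.mem_univ k))).resolve_left (mem_posPart.1 hk).ne'

end Forms

/-! ### The sets `Omega V` and `reducedSet V`. -/

section Omega

variable {p : ℕ} {V : Set (Fin p → ℝ)}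

theorem le_rho_iff (hV : V.Nonempty) (s : ℝ) (t : Fin p → ℝ) :
    s ≤ rho t V ↔ ∀ τ ∈ V, s ≤ ∑ k, |t k - τ k| := by
  unfold rho
  rw [le_csInf_iff ⟨0, ?_⟩ (hV.image _), Set.forall_mem_image]
  rintro _ ⟨τ, _, rfl⟩
  exact Finset.sum_nonneg fun k _ => abs_nonneg _

theorem sigma_le {v : Fin p → ℝ} (hv : v ∈ V) {k : Fin p} (hk : 0 < v k) : sigma V ≤ v k := by
  refine csInf_le ⟨0, ?_⟩ ⟨v, hv, k, mem_posPart.2 hk, rfl⟩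
  rintro _ ⟨w, _, l, hl, rfl⟩
  exact (mem_posPart.1 hl).le

theorem sigma_pos (hV : V.Nonempty) (hf : V.Finite) (hT : V ⊆ T p) : 0 < sigma V := by
  have hS : {r | ∃ v ∈ V, ∃ k ∈ posPart v, r = v k}.Finite := by
    refine (hf.prod (Set.finite_univ (α := Fin p))).image (fun x => x.1 x.2) |>.subset ?_
    rintro _ ⟨v, hv, k, _, rfl⟩
    exact ⟨(v, k), ⟨hv, trivial⟩, rfl⟩
  have hne : {r | ∃ v ∈ V, ∃ k ∈ posPart v, r = v k}.Nonempty := by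
    obtain ⟨v, hv⟩ := hV
    obtain ⟨k, -, hk⟩ := Finset.exists_lt_of_sum_lt (s := Finset.univ) (f := fun _ => (0 : ℝ))
      (g := v) (by simp [T_sum (hT hv)])
    exact ⟨v k, v, hv, k, mem_posPart.2 hk, rfl⟩
  obtain ⟨v, _, k, hk, h⟩ := hne.csInf_mem hS
  rw [sigma, h]
  exact mem_posPart.1 hk

theorem isCompact_Omega (V : Set (Fin p → ℝ)) : IsCompact (Omega V) := by
  refine (isCompact_T p).of_isClosed_subset ?_ fun t ht => ht.1
  refine (isCompact_T p).isClosed.inter (?_ : IsClosed {t | V.Nonempty → _})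
  by_cases hV : V.Nonempty
  · simp only [hV, true_imp_iff, le_rho_iff hV.convexHull, Set.ofPred_forall]
    exact isClosed_biInter fun τ _ => isClosed_le continuous_const (by fun_prop)
  · simp [hV]

/-- The points of the simplex whose support contains the support of no point of `V`. -/
def reducedSet (V : Set (Fin p → ℝ)) : Set (Fin p → ℝ) :=
  {t | t ∈ T p ∧ ∀ v ∈ V, ∃ k, t k = 0 ∧ 0 < v k}

theorem isCompact_reducedSet (V : Set (Fin p → ℝ)) : IsCompact (reducedSet V) := by
  refine (isCompact_T p).of_isClosed_subset ?_ fun t ht => ht.1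
  refine (isCompact_T p).isClosed.inter (?_ : IsClosed {t | ∀ v ∈ V, _})
  simp only [Set.ofPred_forall, Set.ofPred_exists]
  refine isClosed_biInter fun v _ => isClosed_iUnion_of_finite fun k => ?_
  exact (isClosed_eq (continuous_apply k) continuous_const).inter isClosed_const

/-- The mass of `τ` on the zero coordinates of `t` bounds the `ℓ¹` distance from below. It is linear
in `τ` and at least `sigma V` at each point of `V`, hence on the convex hull. -/
theorem reducedSet_subset_Omega (hT : V ⊆ T p) : reducedSet V ⊆ Omega V := by
  rintro t ⟨ht, h⟩
  refine ⟨ht, fun hV => (le_rho_iff hV.convexHull _ _).2 fun τ hτ => ?_⟩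
  have hc : ConcaveOn ℝ (T p) fun τ : Fin p → ℝ => ∑ k, if t k = 0 then τ k else 0 := by
    refine ⟨convex_stdSimplex ℝ _, fun x _ y _ a b _ _ _ => le_of_eq ?_⟩
    simp only [smul_eq_mul, Finset.mul_sum, ← Finset.sum_add_distrib]
    exact Finset.sum_congr rfl fun k _ => by split_ifs <;> simp
  have hsub : V ⊆ {τ ∈ T p | sigma V ≤ ∑ k, if t k = 0 then τ k else 0} := by
    refine fun v hv => ⟨hT hv, ?_⟩
    obtain ⟨k, hk, hvk⟩ := h v hv
    refine (sigma_le hv hvk).trans ?_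
    refine le_trans (by simp [hk]) (Finset.single_le_sum (f := fun k => if t k = 0 then v k else 0)
      (fun l _ => ?_) (Finset.mem_univ k))
    split_ifs
    exacts [T_nonneg (hT hv) l, le_rfl]
  refine (convexHull_min hsub (hc.convex_ge _) hτ).2.trans (Finset.sum_le_sum fun k _ => ?_)
  split_ifs with hk
  · rw [hk, zero_sub, abs_neg]
    exact le_abs_self _
  · exact abs_nonneg _

/-- Subtracting multiples of points of `V` from `t` until no support of a point of `V` is left. -/
theorem exists_add_smul_convexHull (hV : V.Nonempty) (hT : V ⊆ T p) {t : Fin p → ℝ}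
    (ht : ∀ k, 0 ≤ t k) : ∃ u : Fin p → ℝ, (∀ k, 0 ≤ u k) ∧
      (∀ v ∈ V, ∃ k, u k = 0 ∧ 0 < v k) ∧
      ∃ r : ℝ, 0 ≤ r ∧ ∃ w ∈ convexHull ℝ V, t = u + r • w := by
  induction hn : (posPart t).card using Nat.strong_induction_on generalizing t with
  | _ n ih =>
  subst hn
  by_cases h : ∀ v ∈ V, ∃ k, t k = 0 ∧ 0 < v k
  · obtain ⟨v, hv⟩ := hV
    exact ⟨t, ht, h, 0, le_rfl, v, subset_convexHull ℝ V hv, by simp⟩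
  push Not at h
  obtain ⟨v, hv, hvt⟩ := h
  have hpos : ∀ k, 0 < v k → 0 < t k := fun k hk =>
    (ht k).lt_of_ne' fun h0 => (hvt k h0).not_gt hk
  obtain ⟨k₀, -, hk₀⟩ := Finset.exists_lt_of_sum_lt (s := Finset.univ) (f := fun _ => (0 : ℝ))
    (g := v) (by simp [T_sum (hT hv)])
  obtain ⟨k, hk, hmin⟩ := (posPart v).exists_min_image (fun k => t k / v k)
    ⟨k₀, mem_posPart.2 hk₀⟩
  rw [mem_posPart] at hk
  -- The largest multiple of `v` that fits below `t`; removing it deletes `k` from the support, so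
  -- the induction descends.
  set s := t k / v k with hs
  have hs0 : 0 < s := div_pos (hpos k hk) hk
  have hsub : ∀ l, 0 ≤ (t - s • v) l := by
    intro l
    simp only [Pi.sub_apply, Pi.smul_apply, smul_eq_mul, sub_nonneg]
    rcases (T_nonneg (hT hv) l).eq_or_lt with h0 | h0
    · simpa [← h0] using ht l
    · exact (le_div_iff₀ h0).1 (hmin l (mem_posPart.2 h0))
  have hcard : (posPart (t - s • v)).card < (posPart t).card := by
    refine Finset.card_lt_card (Finset.ssubset_iff_of_subset ?_ |>.2 ⟨k, ?_, ?_⟩)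
    · intro l hl
      rw [mem_posPart] at hl ⊢
      have := mul_nonneg hs0.le (T_nonneg (hT hv) l)
      simp only [Pi.sub_apply, Pi.smul_apply, smul_eq_mul] at hl
      linarith
    · exact mem_posPart.2 (hpos k hk)
    · simp [mem_posPart, hs, div_mul_cancel₀ _ hk.ne']
  obtain ⟨u, hu, huV, r, hr, w, hw, hur⟩ := ih _ hcard hsub rfl
  have hrs : 0 < r + s := by linarith
  refine ⟨u, hu, huV, r + s, hrs.le, (r / (r + s)) • w + (s / (r + s)) • v,
    convex_convexHull ℝ V hw (subset_convexHull ℝ V hv) (by positivity) (by positivity)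
      (by field_simp), ?_⟩
  rw [smul_add, smul_smul, smul_smul, mul_div_cancel₀ _ hrs.ne', mul_div_cancel₀ _ hrs.ne',
    ← add_assoc, ← hur, sub_add_cancel]

theorem row_nonneg_of_mem_convexHull {D : SymMat p} (h : ∀ v ∈ V, ∀ k, 0 ≤ row D k v)
    {w : Fin p → ℝ} (hw : w ∈ convexHull ℝ V) (k : Fin p) : 0 ≤ row D k w := by
  refine convexHull_min (t := {w | ∀ k, 0 ≤ row D k w}) h ?_ hw k
  intro x hx y hy a b ha hb _ k
  rw [row_add_right, row_smul_right, row_smul_right]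
  exact add_nonneg (mul_nonneg ha (hx k)) (mul_nonneg hb (hy k))

/-- Each nonnegative vector is dominated by a multiple of a point of `reducedSet V`, up to a
multiple of a point of the convex hull of `V`. -/
theorem exists_quad_le (hT : V ⊆ T p) {D : SymMat p} (h : ∀ v ∈ V, ∀ k, 0 ≤ row D k v)
    {t : Fin p → ℝ} (ht : t ∈ T p) :
    t ∈ convexHull ℝ V ∧ 0 ≤ quad D t ∨
      ∃ u ∈ reducedSet V, ∃ r : ℝ, 0 < r ∧ r * quad D u ≤ quad D t := by
  rcases V.eq_empty_or_nonempty with rfl | hV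
  · exact Or.inr ⟨t, ⟨ht, by simp⟩, 1, one_pos, by simp⟩
  obtain ⟨u, hu, huV, r, hr, w, hw, rfl⟩ := exists_add_smul_convexHull hV hT (T_nonneg ht)
  have hwT : w ∈ T p := convexHull_min hT (convex_stdSimplex ℝ _) hw
  have hle : quad D u ≤ quad D (u + r • w) := by
    have hrow : ∀ k, 0 ≤ row D k (r • w) := fun k => by
      rw [row_smul_right]
      exact mul_nonneg hr (row_nonneg_of_mem_convexHull h hw k)
    have h1 : 0 ≤ ∑ k, u k * row D k (r • w) :=
      Finset.sum_nonneg fun k _ => mul_nonneg (hu k) (hrow k)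
    have h2 : 0 ≤ quad D (r • w) := by
      rw [quad_eq_sum]
      exact Finset.sum_nonneg fun k _ => mul_nonneg (mul_nonneg hr (T_nonneg hwT k)) (hrow k)
    rw [quad_add_right]
    linarith
  by_cases h0 : u = 0
  · subst h0
    left
    rw [quad_zero_right] at hle
    refine ⟨?_, hle⟩
    -- Compare coordinate sums: both `t` and `w` lie in the simplex.
    have : r = 1 := by
      have := T_sum ht
      simpa [← Finset.mul_sum, T_sum hwT] using this
    simpa [this] using hw
  · right
    have hs := sum_pos_of_ne_zero hu h0
    refine ⟨_, ⟨inv_sum_smul_mem_T hu hs, fun v hv => ?_⟩, (∑ k, u k) ^ 2, by positivity, ?_⟩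
    · obtain ⟨k, hk, hvk⟩ := huV v hv
      exact ⟨k, by simp [hk], hvk⟩
    · rw [quad_smul_right, ← mul_assoc, ← mul_pow, mul_inv_cancel₀ hs.ne', one_pow, one_mul]
      exact hle

theorem notMem_convexHull_of_mem_Omega (hf : V.Finite) (hT : V ⊆ T p) {t : Fin p → ℝ}
    (ht : t ∈ Omega V) : t ∉ convexHull ℝ V := by
  intro h
  have hV : V.Nonempty := convexHull_nonempty_iff.1 ⟨t, h⟩
  have := (le_rho_iff hV.convexHull _ _).1 (ht.2 hV) t h
  simp only [sub_self, abs_zero, Finset.sum_const_zero] at this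
  exact this.not_gt (sigma_pos hV hf hT)

end Omega

/-! ### The invariant and the regularized feasible set. -/

namespace Problem

variable {n p : ℕ} {P : Problem n p} {s s' : State p}

theorem mat_eq_sum (P : Problem n p) (x : Fin n → ℝ) :
    P.mat x = ∑ j, (Fin.cons 1 x : Fin (n + 1) → ℝ) j • P.A j := by
  simp [mat, Fin.sum_univ_succ]

theorem quad_mat (P : Problem n p) (x : Fin n → ℝ) (t : Fin p → ℝ) :
    quad (P.mat x) t = ∑ j, (Fin.cons 1 x : Fin (n + 1) → ℝ) j * quad (P.A j) t := by
  rw [mat_eq_sum, quad_sum_smul]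

theorem row_mat (P : Problem n p) (x : Fin n → ℝ) (k : Fin p) (t : Fin p → ℝ) :
    row (P.mat x) k t = ∑ j, (Fin.cons 1 x : Fin (n + 1) → ℝ) j * row (P.A j) k t := by
  rw [mat_eq_sum, row_sum_smul]

/-- The invariant of the algorithm: the points `τ i` are immobile indices, and the coordinates in
`L i` give active constraints on the whole feasible set. -/
def Immobile (P : Problem n p) (s : State p) : Prop :=
  ∀ i ∈ s.I, s.τ i ∈ P.Tim ∧ posPart (s.τ i) ⊆ s.L i ∧
    ∀ k ∈ s.L i, ∀ x ∈ P.X, row (P.mat x) k (s.τ i) = 0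

theorem row_nonneg_of_mem_Tim {t : Fin p → ℝ} (ht : t ∈ P.Tim) {x : Fin n → ℝ} (hx : x ∈ P.X)
    (k : Fin p) : 0 ≤ row (P.mat x) k t :=
  row_nonneg_of_mem_COP hx (T_nonneg ht.1) (ht.2 x hx) k

theorem row_eq_zero_of_mem_Tim {t : Fin p → ℝ} (ht : t ∈ P.Tim) {x : Fin n → ℝ} (hx : x ∈ P.X)
    {k : Fin p} (hk : k ∈ posPart t) : row (P.mat x) k t = 0 :=
  row_eq_zero_of_mem_COP hx (T_nonneg ht.1) (ht.2 x hx) hk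

theorem Immobile.W_subset (h : P.Immobile s) : s.W ⊆ T p := by
  rintro _ ⟨i, hi, rfl⟩
  exact (h i hi).1.1

theorem W_finite (s : State p) : s.W.Finite := s.I.finite_toSet.image _

theorem Immobile.linearConstraints (h : P.Immobile s) {x : Fin n → ℝ} (hx : x ∈ P.X) :
    P.LinearConstraints s x := fun i hi =>
  ⟨fun k hk => (h i hi).2.2 k hk x hx, fun k _ => row_nonneg_of_mem_Tim (h i hi).1 hx k⟩

theorem LinearConstraints.row_nonneg {x : Fin n → ℝ} (h : P.LinearConstraints s x) :
    ∀ v ∈ s.W, ∀ k, 0 ≤ row (P.mat x) k v := by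
  rintro _ ⟨i, hi, rfl⟩ k
  by_cases hk : k ∈ s.L i
  exacts [((h i hi).1 k hk).ge, (h i hi).2 k hk]

theorem regFeasible_eq (h : P.Immobile s) : P.regFeasible s = P.X := by
  ext x
  constructor
  · rintro ⟨hl, hq⟩
    refine mem_COP_of_T fun t ht => ?_
    rcases exists_quad_le h.W_subset hl.row_nonneg ht with ⟨-, h0⟩ | ⟨u, hu, r, hr, hle⟩
    · exact h0
    · exact (mul_nonneg hr.le (hq u (reducedSet_subset_Omega h.W_subset hu))).trans hle
  · exact fun hx => ⟨h.linearConstraints hx, fun t ht => hx t (T_nonneg ht.1)⟩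

theorem stops_of_pos (h : P.Immobile s) {x : Fin n → ℝ} (hl : P.LinearConstraints s x)
    (hq : ∀ t ∈ reducedSet s.W, 0 < quad (P.mat x) t) : P.Stops s := by
  have hpos : ∀ t ∈ Omega s.W, 0 < quad (P.mat x) t := fun t ht => by
    rcases exists_quad_le h.W_subset hl.row_nonneg ht.1 with ⟨h0, -⟩ | ⟨u, hu, r, hr, hle⟩
    · exact absurd h0 (notMem_convexHull_of_mem_Omega (W_finite s) h.W_subset ht)
    · exact (mul_pos hr (hq u hu)).trans_le hle
  -- With no index left any negative `μ` will do; otherwise the minimum of the form over the compact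
  -- set is used.
  rcases (Omega s.W).eq_empty_or_nonempty with h0 | h0
  · exact ⟨x, -1, ⟨hl, by simp [h0]⟩, by norm_num⟩
  · obtain ⟨t, ht, hmin⟩ := (isCompact_Omega s.W).exists_isMinOn h0
      (continuous_quad_right (P.mat x)).continuousOn
    refine ⟨x, -quad (P.mat x) t, ⟨hl, fun u hu => ?_⟩, neg_lt_zero.2 (hpos t ht)⟩
    have : quad (P.mat x) t ≤ quad (P.mat x) u := hmin hu
    linarith

/-! ### Duality: existence of the data required in an iteration. -/

/-- The evaluation `z ↦ z₀ + ∑ xⱼ zⱼ` at the point `x`. -/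
def evalAt (x : Fin n → ℝ) : (Fin (n + 1) → ℝ) →ₗ[ℝ] ℝ :=
  Fintype.linearCombination ℝ (Fin.cons 1 x : Fin (n + 1) → ℝ)

theorem evalAt_apply (x : Fin n → ℝ) (z : Fin (n + 1) → ℝ) :
    evalAt x z = ∑ j, (Fin.cons 1 x : Fin (n + 1) → ℝ) j * z j := by
  simp [evalAt, Fintype.linearCombination_apply, mul_comm]

theorem evalAt_ne_zero (x : Fin n → ℝ) : evalAt x ≠ 0 := fun h => by
  have := LinearMap.congr_fun h (Pi.single 0 1)
  simp [evalAt_apply, Pi.single_apply] at this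

/-- A functional is, after adding a multiple of `evalAt x`, a positive multiple of an
evaluation. -/
theorem exists_evalAt_eq (f : (Fin (n + 1) → ℝ) →ₗ[ℝ] ℝ) (x : Fin n → ℝ) :
    ∃ M c : ℝ, 0 ≤ M ∧ 0 < c ∧ ∃ y : Fin n → ℝ, ∀ z, evalAt y z = c * (f z + M * evalAt x z) := by
  set e : Fin (n + 1) → Fin (n + 1) → ℝ := fun j => Pi.single j 1
  have hf : ∀ z, f z = ∑ j, f (e j) * z j := fun z => by
    conv_lhs => rw [pi_eq_sum_univ' z]
    simp [e, mul_comm]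
  -- An evaluation has leading coefficient 1, so that of `f` must be made positive before
  -- normalizing.
  have hpos : 0 < f (e 0) + (|f (e 0)| + 1) := by
    have := neg_abs_le (f (e 0))
    linarith
  set M := |f (e 0)| + 1
  refine ⟨M, (f (e 0) + M)⁻¹, by positivity, inv_pos.2 hpos,
    fun j => (f (e 0) + M)⁻¹ * (f (e j.succ) + M * x j), fun z => ?_⟩
  rw [evalAt_apply, evalAt_apply, hf z, Finset.mul_sum, ← Finset.sum_add_distrib, Finset.mul_sum]
  refine Finset.sum_congr rfl fun j _ => ?_
  refine Fin.cases ?_ (fun j => ?_) j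
  · simp only [Fin.cons_zero]
    field_simp
  · simp only [Fin.cons_succ]
    ring

/-- Multipliers certifying that the optimal value of the auxiliary problem is zero. -/
theorem exists_certificate (hX : P.X.Nonempty) (h : P.Immobile s) (hs : ¬ P.Stops s) :
    ∃ (Δ : Finset ℕ) (t : ℕ → Fin p → ℝ) (γ : ℕ → ℝ) (lam : ℕ → Fin p → ℝ),
      Disjoint Δ s.I ∧ 1 ≤ Δ.card ∧ Δ.card ≤ n + 1 ∧
      (∀ i ∈ Δ, t i ∈ reducedSet s.W ∧ 0 < γ i) ∧ ∑ i ∈ Δ, γ i = 1 ∧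
      (∀ i ∈ s.I, ∀ k, k ∉ s.L i → 0 ≤ lam i k) ∧
      ∀ j : Fin (n + 1), ∑ i ∈ Δ, γ i * quad (P.A j) (t i) +
        2 * ∑ i ∈ s.I, ∑ k, lam i k * row (P.A j) k (s.τ i) = 0 := by
  obtain ⟨x, hx⟩ := hX
  let a : (Fin p → ℝ) → Fin (n + 1) → ℝ := fun t j => quad (P.A j) t
  let b : s.I × Fin p → Fin (n + 1) → ℝ := fun i j => row (P.A j) i.2 (s.τ i.1)
  have ha : Continuous a := continuous_pi fun j => continuous_quad_right (P.A j)
  have ea : ∀ y t, evalAt y (a t) = quad (P.mat y) t := fun y t => by rw [quad_mat, evalAt_apply]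
  have eb : ∀ y i, evalAt y (b i) = row (P.mat y) i.2 (s.τ i.1) := fun y i => by
    rw [row_mat, evalAt_apply]
  have hb0 : ∀ i, 0 ≤ evalAt x (b i) := fun i => by
    rw [eb]
    exact row_nonneg_of_mem_Tim (h i.1 i.1.2).1 hx i.2
  have ha0 : ∀ t ∈ reducedSet s.W, 0 ≤ evalAt x (a t) := fun t ht => by
    rw [ea]
    exact hx t (T_nonneg ht.1)
  rcases exists_mem_add_sum_eq_zero_or_exists_pos
    (isCompact_convexHull_of_isCompact ((isCompact_reducedSet s.W).image ha))
    (convex_convexHull ℝ _) b {i | i.2 ∈ s.L i.1} with ⟨z, hz, c, hc, hzc⟩ | ⟨f, hfK, hfb, hfF⟩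
  · obtain ⟨κ, _, z', w, hz', hind, hw, hw1, rfl⟩ := eq_pos_convex_span_of_mem_convexHull hz
    have hz'' : ∀ i, ∃ t ∈ reducedSet s.W, a t = z' i := fun i => hz' ⟨i, rfl⟩
    choose t ht htz using hz''
    have hcb : ∀ i, 0 ≤ c i * evalAt x (b i) := fun i => by
      by_cases hi : i.2 ∈ s.L i.1
      · rw [eb, (h i.1 i.1.2).2.2 _ hi x hx, mul_zero]
      · exact mul_nonneg (hc i hi) (hb0 i)
    have hwz : ∀ i, 0 ≤ w i * evalAt x (z' i) := fun i => by
      rw [← htz]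
      exact mul_nonneg (hw i).le (ha0 _ (ht i))
    -- The points lie in a hyperplane through the origin, which improves the Carathéodory bound from
    -- `n + 2` to `n + 1`.
    have hz0 : ∀ i, evalAt x (z' i) = 0 := fun i => by
      have h1 := congrArg (evalAt x) hzc
      simp only [map_add, map_sum, map_smul, smul_eq_mul, map_zero] at h1
      have h2 := Finset.sum_nonneg fun i (_ : i ∈ Finset.univ) => hcb i
      have h3 := Finset.sum_nonneg fun i (_ : i ∈ Finset.univ) => hwz i
      have h4 := (Finset.sum_eq_zero_iff_of_nonneg fun i _ => hwz i).1 (by linarith)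
        i (Finset.mem_univ i)
      exact (mul_eq_zero.1 h4).resolve_left (hw i).ne'
    have hcard : Fintype.card κ ≤ n + 1 := by
      simpa using card_le_finrank_of_affineIndependent_of_ker hind (evalAt_ne_zero x) hz0
    have hne : Nonempty κ := by
      by_contra hκ
      rw [not_nonempty_iff] at hκ
      simp at hw1
    -- Fresh labels, all beyond the largest old index. Halving `c` below compensates the factor 2 in
    -- the multiplier rule.
    let φ : κ ↪ ℕ := ⟨fun i => s.I.sup id + 1 + Fintype.equivFin κ i, fun i j hij => by
      simpa [Fin.val_inj] using hij⟩
    refine ⟨Finset.univ.map φ, Function.extend φ t 0, Function.extend φ w 0,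
      fun i k => if hi : i ∈ s.I then c (⟨i, hi⟩, k) / 2 else 0, ?_, ?_, ?_, ?_, ?_, ?_, ?_⟩
    · rw [Finset.disjoint_left]
      intro i hi hi'
      obtain ⟨l, -, rfl⟩ := Finset.mem_map.1 hi
      have : s.I.sup id + 1 + (Fintype.equivFin κ l : ℕ) ≤ s.I.sup id := Finset.le_sup (f := id) hi'
      lia
    · rw [Finset.card_map, Finset.card_univ]
      exact Fintype.card_pos
    · rwa [Finset.card_map, Finset.card_univ]
    · intro i hi
      obtain ⟨l, -, rfl⟩ := Finset.mem_map.1 hi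
      rw [φ.injective.extend_apply, φ.injective.extend_apply]
      exact ⟨ht l, hw l⟩
    · simpa [Finset.sum_map, φ.injective.extend_apply] using hw1
    · intro i hi k hk
      simp only [dif_pos hi]
      exact div_nonneg (hc (⟨i, hi⟩, k) hk) two_pos.le
    · intro j
      have h1 := congrFun hzc j
      simp only [Pi.add_apply, Finset.sum_apply, Pi.smul_apply, smul_eq_mul, Pi.zero_apply,
        Fintype.sum_prod_type, ← htz] at h1
      rw [← h1, Finset.sum_map]
      simp only [φ.injective.extend_apply]
      congr 1
      rw [← Finset.sum_coe_sort s.I, Finset.mul_sum]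
      refine Finset.sum_congr rfl fun i _ => ?_
      rw [Finset.mul_sum]
      refine Finset.sum_congr rfl fun k _ => ?_
      simp only [Finset.coe_mem, dif_pos, b, Subtype.coe_eta]
      ring
  · refine absurd ?_ hs
    -- Adding the feasible evaluation at `x` keeps all signs of `f`, so `y` would make the test
    -- succeed.
    obtain ⟨M, r, hM, hr, y, hy⟩ := exists_evalAt_eq f x
    refine stops_of_pos h (x := y) (fun i hi => ⟨fun k hk => ?_, fun k _ => ?_⟩) fun t ht => ?_
    · rw [← eb y (⟨i, hi⟩, k), hy, hfF _ hk, eb, (h i hi).2.2 k hk x hx]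
      simp
    · rw [← eb y (⟨i, hi⟩, k), hy]
      exact mul_nonneg hr.le (add_nonneg (hfb _) (mul_nonneg hM (hb0 _)))
    · rw [← ea, hy]
      exact mul_pos hr (add_pos_of_pos_of_nonneg
        (hfK _ (subset_convexHull ℝ _ ⟨t, ht, rfl⟩)) (mul_nonneg hM (ha0 t ht)))

theorem exists_firstStep (hX : P.X.Nonempty) (hI : s.I = ∅) (hs : ¬ P.Stops s) :
    ∃ s', P.FirstStep s' := by
  obtain ⟨Δ, t, γ, lam, -, -, hcard, hΔ, hγ, -, hsum⟩ :=
    exists_certificate hX (fun i hi => by simp [hI] at hi) hs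
  exact ⟨⟨Δ, t, fun i => posPart (t i)⟩, γ, hcard, fun i hi => ⟨(hΔ i hi).1.1, (hΔ i hi).2, rfl⟩,
    fun j => by simpa only [hI, Finset.sum_empty, mul_zero, add_zero] using hsum j, hγ⟩

theorem exists_nextStep (hX : P.X.Nonempty) (h : P.Immobile s) (hs : ¬ P.Stops s) :
    ∃ s', P.NextStep s s' := by
  classical
  obtain ⟨Δ, t, γ, lam, hd, hcard₁, hcard, hΔ, -, hlam, hsum⟩ := exists_certificate hX h hs
  have hdI : ∀ i ∈ Δ, i ∉ s.I := fun i hi => Finset.disjoint_left.1 hd hi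
  refine ⟨⟨s.I ∪ Δ, fun i => if i ∈ s.I then s.τ i else t i, fun i => if i ∈ s.I then
    s.L i ∪ Finset.univ.filter (fun k => k ∉ s.L i ∧ 0 < lam i k) else posPart (t i)⟩,
    Δ, γ, lam, hd, hcard₁, hcard, fun i hi => ?_, hlam, fun j => ?_, fun i hi j hj => ?_, rfl,
    fun i hi => if_pos hi, fun i hi => ?_, fun i hi => ?_⟩
  · simp only [if_neg (hdI i hi)]
    exact ⟨reducedSet_subset_Omega h.W_subset (hΔ i hi).1, (hΔ i hi).2⟩
  · refine Eq.trans (congrArg (· + _) (Finset.sum_congr rfl fun i hi => ?_)) (hsum j)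
    simp only [if_neg (hdI i hi)]
  · obtain ⟨k, hk, hkv⟩ := (hΔ i hi).1.2 _ ⟨j, hj, rfl⟩
    refine ⟨k, ?_, mem_posPart.2 hkv⟩
    simp [mem_posPart, hdI i hi, hk]
  · simp only [if_pos hi]
  · simp only [if_neg (hdI i hi)]

/-! ### Preservation of the invariant along a run. -/

theorem immobile_of_mem_T_of_quad_eq_zero {t : Fin p → ℝ} (ht : t ∈ T p)
    (h : ∀ x ∈ P.X, quad (P.mat x) t = 0) : t ∈ P.Tim ∧ ∀ k ∈ posPart t, ∀ x ∈ P.X,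
      row (P.mat x) k t = 0 :=
  ⟨⟨ht, h⟩, fun _ hk _ hx => row_eq_zero_of_mem_Tim ⟨ht, h⟩ hx hk⟩

theorem FirstStep.immobile (h : P.FirstStep s') : P.Immobile s' := by
  obtain ⟨γ, -, hI, hsum, -⟩ := h
  intro i hi
  obtain ⟨hT, hγ, hL⟩ := hI i hi
  rw [hL]
  obtain ⟨h1, h2⟩ := immobile_of_mem_T_of_quad_eq_zero (P := P) hT fun x hx => by
    have h0 : ∑ i ∈ s'.I, γ i * quad (P.mat x) (s'.τ i) = 0 := by
      simp only [quad_mat, Finset.mul_sum]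
      rw [Finset.sum_comm]
      refine Finset.sum_eq_zero fun j _ => ?_
      simp only [mul_left_comm (γ _)]
      rw [← Finset.mul_sum, hsum j, mul_zero]
    rw [Finset.sum_eq_zero_iff_of_nonneg fun i hi =>
      mul_nonneg (hI i hi).2.1.le (hx _ (T_nonneg (hI i hi).1))] at h0
    exact (mul_eq_zero.1 (h0 i hi)).resolve_left hγ.ne'
  exact ⟨h1, subset_rfl, h2⟩

theorem NextStep.immobile (hs : P.Immobile s) (h : P.NextStep s s') : P.Immobile s' := by
  obtain ⟨Δ, γ, lam, -, -, -, hΔ, hlam, hsum, -, hI, hτ, hL, hLΔ⟩ := h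
  have hg : ∀ x ∈ P.X, ∀ i ∈ Δ, 0 ≤ γ i * quad (P.mat x) (s'.τ i) := fun x hx i hi =>
    mul_nonneg (hΔ i hi).2.le (hx _ (T_nonneg (hΔ i hi).1.1))
  have hr : ∀ x ∈ P.X, ∀ i ∈ s.I, ∀ k, 0 ≤ lam i k * row (P.mat x) k (s.τ i) := by
    intro x hx i hi k
    by_cases hk : k ∈ s.L i
    · rw [(hs i hi).2.2 k hk x hx, mul_zero]
    · exact mul_nonneg (hlam i hi k hk) (row_nonneg_of_mem_Tim (hs i hi).1 hx k)
  have h0 : ∀ x : Fin n → ℝ, ∑ i ∈ Δ, γ i * quad (P.mat x) (s'.τ i) +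
      2 * ∑ i ∈ s.I, ∑ k, lam i k * row (P.mat x) k (s.τ i) = 0 := fun x => by
    have h1 : ∑ i ∈ Δ, γ i * quad (P.mat x) (s'.τ i) =
        ∑ j, (Fin.cons 1 x : Fin (n + 1) → ℝ) j * ∑ i ∈ Δ, γ i * quad (P.A j) (s'.τ i) := by
      simp only [quad_mat, Finset.mul_sum]
      rw [Finset.sum_comm]
      simp only [mul_left_comm (γ _)]
    have h2 : ∑ i ∈ s.I, ∑ k, lam i k * row (P.mat x) k (s.τ i) =
        ∑ j, (Fin.cons 1 x : Fin (n + 1) → ℝ) j *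
          ∑ i ∈ s.I, ∑ k, lam i k * row (P.A j) k (s.τ i) := by
      simp only [row_mat, Finset.mul_sum]
      conv_rhs => rw [Finset.sum_comm]
      refine Finset.sum_congr rfl fun i _ => ?_
      conv_rhs => rw [Finset.sum_comm]
      simp only [mul_left_comm (lam _ _)]
    rw [h1, h2, Finset.mul_sum, ← Finset.sum_add_distrib]
    refine Finset.sum_eq_zero fun j _ => ?_
    rw [mul_left_comm, ← mul_add, hsum j, mul_zero]
  have hg0 : ∀ x ∈ P.X, ∀ i ∈ Δ, γ i * quad (P.mat x) (s'.τ i) = 0 := fun x hx => by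
    have h1 := Finset.sum_nonneg (hg x hx)
    have h2 : 0 ≤ ∑ i ∈ s.I, ∑ k, lam i k * row (P.mat x) k (s.τ i) :=
      Finset.sum_nonneg fun i hi => Finset.sum_nonneg fun k _ => hr x hx i hi k
    exact (Finset.sum_eq_zero_iff_of_nonneg (hg x hx)).1 (by linarith [h0 x])
  have hr0 : ∀ x ∈ P.X, ∀ i ∈ s.I, ∀ k, lam i k * row (P.mat x) k (s.τ i) = 0 :=
    fun x hx i hi k => by
      have h1 := Finset.sum_nonneg (hg x hx)
      have h2 : ∀ i ∈ s.I, 0 ≤ ∑ k, lam i k * row (P.mat x) k (s.τ i) :=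
        fun i hi => Finset.sum_nonneg fun k _ => hr x hx i hi k
      have h3 := Finset.sum_nonneg h2
      have h4 := (Finset.sum_eq_zero_iff_of_nonneg h2).1 (by linarith [h0 x]) i hi
      exact (Finset.sum_eq_zero_iff_of_nonneg fun k _ => hr x hx i hi k).1 h4 k (Finset.mem_univ k)
  intro i hi
  rw [hI, Finset.mem_union] at hi
  rcases hi with hi | hi
  · rw [hτ i hi, hL i hi]
    refine ⟨(hs i hi).1, (hs i hi).2.1.trans Finset.subset_union_left, fun k hk x hx => ?_⟩
    rcases Finset.mem_union.1 hk with hk | hk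
    · exact (hs i hi).2.2 k hk x hx
    · exact (mul_eq_zero.1 (hr0 x hx i hi k)).resolve_left (Finset.mem_filter.1 hk).2.2.ne'
  · rw [hLΔ i hi]
    obtain ⟨h1, h2⟩ := immobile_of_mem_T_of_quad_eq_zero (P := P) (hΔ i hi).1.1 fun x hx =>
      (mul_eq_zero.1 (hg0 x hx i hi)).resolve_left (hΔ i hi).2.ne'
    exact ⟨h1, subset_rfl, h2⟩

theorem IsRun.of_le {s : ℕ → State p} {k m : ℕ} (h : P.IsRun m s) (hk : k ≤ m) : P.IsRun k s :=
  ⟨h.1, fun l hl => h.2 l (hl.trans_le hk)⟩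

theorem IsRun.immobile {m : ℕ} {s : ℕ → State p} (h : P.IsRun m s) : P.Immobile (s m) := by
  induction m with
  | zero => exact fun i hi => by simp [h.1] at hi
  | succ m ih =>
    have hm := ih (h.of_le m.le_succ)
    have hstep := (h.2 m m.lt_succ_self).2
    cases m with
    | zero => exact FirstStep.immobile hstep
    | succ m => exact NextStep.immobile hm hstep

theorem IsRun.nonempty {m : ℕ} {s : ℕ → State p} (h : P.IsRun m s) (hm : 0 < m) :
    (s m).I.Nonempty := by
  obtain ⟨m, rfl⟩ := Nat.exists_eq_succ_of_ne_zero hm.ne'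
  have hstep := (h.2 m m.lt_succ_self).2
  cases m with
  | zero =>
    obtain ⟨γ, -, -, -, h1⟩ := hstep
    rw [Finset.nonempty_iff_ne_empty]
    intro h0
    simp [h0] at h1
  | succ m =>
    obtain ⟨Δ, _, _, -, h1, -, -, -, -, -, hI, -⟩ := hstep
    rw [hI]
    exact (Finset.card_pos.1 h1).inr

/-! ### Progress and termination. -/

theorem exists_step (hX : P.X.Nonempty) {m : ℕ} {s : ℕ → State p} (h : P.IsRun m s)
    (hs : ¬ P.Stops (s m)) : ∃ s', P.Step m (s m) s' := by
  cases m with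
  | zero => exact exists_firstStep hX h.1 hs
  | succ m => exact exists_nextStep hX h.immobile hs

/-- The supports of the points chosen in different iterations are different, so there are only
finitely many iterations. -/
theorem not_forall_isRun (P : Problem n p) (s : ℕ → State p) : ¬ ∀ m, P.IsRun m s := by
  intro h
  have hstep : ∀ m, P.NextStep (s (m + 1)) (s (m + 2)) := fun m =>
    ((h (m + 2)).2 (m + 1) (Nat.lt_succ_self _)).2
  choose Δ γ lam _ hΔ _ _ _ _ hsupp hI hτ _ using hstep
  -- `i m` is created in iteration `m + 1`, so it first appears in `s (m + 2)`; iteration 0 imposes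
  -- no support condition and is skipped.
  choose i hi using fun m => Finset.card_pos.1 (hΔ m)
  have hmem : ∀ m l, i m ∈ (s (m + 2 + l)).I ∧ (s (m + 2 + l)).τ (i m) = (s (m + 2)).τ (i m) := by
    intro m l
    induction l with
    | zero => exact ⟨by simp [hI m, hi m], rfl⟩
    | succ l ih =>
      have h1 := hI (m + 1 + l)
      have h2 := hτ (m + 1 + l)
      rw [show m + 1 + l + 1 = m + 2 + l by ring, show m + 1 + l + 2 = m + 2 + (l + 1) by ring]
        at h1 h2
      exact ⟨by rw [h1]; exact Finset.mem_union_left _ ih.1, (h2 _ ih.1).trans ih.2⟩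
  have hne : ∀ m l, m < l →
      posPart ((s (m + 2)).τ (i m)) ≠ posPart ((s (l + 2)).τ (i l)) := by
    intro m l hml heq
    obtain ⟨d, rfl⟩ := Nat.exists_eq_add_of_lt hml
    have h1 := hmem m d
    rw [show m + 2 + d = m + d + 1 + 1 by ring] at h1
    obtain ⟨k, hk, hk'⟩ := hsupp _ _ (hi _) _ h1.1
    rw [h1.2, heq] at hk'
    exact hk hk'
  refine not_injective_infinite_finite (fun m => posPart ((s (m + 2)).τ (i m))) fun m l hml => ?_
  rcases lt_trichotomy m l with h | h | h
  exacts [(hne m l h hml).elim, h, (hne l m h hml.symm).elim]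

theorem IsRun.congr {m : ℕ} {s s' : ℕ → State p} (h : P.IsRun m s) (hss : ∀ k ≤ m, s k = s' k) :
    P.IsRun m s' := by
  refine ⟨hss 0 m.zero_le ▸ h.1, fun k hk => ?_⟩
  rw [← hss k hk.le, ← hss (k + 1) hk]
  exact h.2 k hk

theorem exists_isRun_stops (hX : P.X.Nonempty) : ∃ m s, P.IsRun m s ∧ P.Stops (s m) := by
  classical
  by_contra! hno
  have hext : ∀ m s, P.IsRun m s → ∃ s' : State p, P.IsRun (m + 1) (Function.update s (m + 1) s') :=
    fun m s h => by
    obtain ⟨s', hs'⟩ := exists_step hX h (hno m s h)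
    refine ⟨s', ?_, fun k hk => ?_⟩
    · simpa [Function.update_of_ne m.succ_ne_zero.symm] using h.1
    · rw [Function.update_of_ne hk.ne]
      rcases (Nat.lt_succ_iff.1 hk).lt_or_eq with hk | rfl
      · rw [Function.update_of_ne (by lia)]
        exact h.2 k hk
      · rw [Function.update_self]
        exact ⟨hno k s h, hs'⟩
  have : Nonempty (State p) := ⟨⟨∅, fun _ => 0, fun _ => ∅⟩⟩
  choose! g hg using hext
  -- `F m` is a run up to iteration `m`. Later extensions leave earlier states alone, so the
  -- diagonal would be an infinite run.
  let F : ℕ → ℕ → State p := fun m =>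
    Nat.rec (fun _ => ⟨∅, fun _ => 0, fun _ => ∅⟩)
      (fun m s => Function.update s (m + 1) (g m s)) m
  have hF : ∀ m, P.IsRun m (F m) := fun m => by
    induction m with
    | zero => exact ⟨rfl, by simp⟩
    | succ m ih => exact hg m _ ih
  have hFk : ∀ k l, F (k + l) k = F k k := fun k l => by
    induction l with
    | zero => rfl
    | succ l ih =>
      rw [← ih]
      exact Function.update_of_ne (by lia) _ _
  refine not_forall_isRun P (fun m => F m m) fun m => (hF m).congr fun k hk => ?_
  obtain ⟨l, rfl⟩ := Nat.exists_eq_add_of_le hk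
  exact hFk k l

end Problem

end LinCop

theorem mainTheorem1 (n p : ℕ) (hp : 1 < p) (P : LinCop.Problem n p) (hX : P.X.Nonempty) :
    -- every iteration at which the stopping test fails can be carried out
    (∀ (m : ℕ) (s : ℕ → LinCop.State p), P.IsRun m s → ¬ P.Stops (s m) →
      ∃ s' : LinCop.State p, P.Step m (s m) s') ∧
    -- no run goes on for ever
    (¬ ∃ s : ℕ → LinCop.State p, ∀ m : ℕ, P.IsRun m s) ∧
    -- hence a run that stops exists
    (∃ (m : ℕ) (s : ℕ → LinCop.State p), P.IsRun m s ∧ P.Stops (s m)) ∧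
    -- properties of the output, for every run stopping at iteration `m` and every point found there
    (∀ (m : ℕ) (s : ℕ → LinCop.State p), P.IsRun m s →
      ∀ (xbar : Fin n → ℝ) (μbar : ℝ), P.SIPFeasible (s m) xbar μbar → μbar < 0 →
        (m = 0 → P.mat xbar ∈ interior (LinCop.COP p)) ∧
        (0 < m → (s m).I.Nonempty) ∧
        (∀ i ∈ (s m).I, (s m).τ i ∈ P.Tim ∧
          LinCop.posPart ((s m).τ i) ⊆ (s m).L i ∧
          ∀ k ∈ (s m).L i, ∀ x ∈ P.X, LinCop.row (P.mat x) k ((s m).τ i) = 0) ∧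
        IsCompact (LinCop.Omega (s m).W) ∧
        xbar ∈ P.X ∧
        (∀ t ∈ LinCop.Omega (s m).W, 0 < LinCop.quad (P.mat xbar) t) ∧
        P.regFeasible (s m) = P.X ∧
        (∀ x : Fin n → ℝ, P.IsOptimalOver (P.regFeasible (s m)) x ↔ P.IsOptimalOver P.X x)) := by
  -- At iteration 0 positivity on `Omega` is positivity on the whole simplex, which is the Slater
  -- condition.
  have hempty : ∀ s : ℕ → LinCop.State p, (s 0).I = ∅ → LinCop.Omega (s 0).W = LinCop.T p := by
    intro s hs
    simp [LinCop.Omega, LinCop.State.W, hs]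
  refine ⟨fun m s h hs => LinCop.Problem.exists_step hX h hs,
    fun ⟨s, hs⟩ => LinCop.Problem.not_forall_isRun P s hs,
    LinCop.Problem.exists_isRun_stops hX, fun m s h xbar μbar hf hμ => ?_⟩
  have him := h.immobile
  have heq := LinCop.Problem.regFeasible_eq him
  have hpos : ∀ t ∈ LinCop.Omega (s m).W, 0 < LinCop.quad (P.mat xbar) t := fun t ht => by
    linarith [hf.2 t ht]
  refine ⟨?_, h.nonempty, him, LinCop.isCompact_Omega _, ?_, hpos, heq, fun x => by rw [heq]⟩
  · rintro rfl
    exact LinCop.mem_interior_COP fun t ht => hpos t (by rwa [hempty s h.1])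
  · rw [← heq]
    exact ⟨hf.1, fun t ht => (hpos t ht).le⟩
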